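/- Let $d \ge 0$ be an integer, let $A \subset \mathbb{Z}^d$ be a finite set, and let $Q = [0,1)^d \subset \mathbb{R}^d$. For $G = \mathbb{Z}^d$ with counting measure or $G = \mathbb{R}^d$ with Lebesgue measure, a subset $\Omega \subseteq G$ of finite measure is called *spectral in $G$* if there is a set $\Lambda$ of continuous characters of $G$ (continuous homomorphisms from $G$ to the circle group $\{z \in \mathbb{C} : |z| = 1\}$) whose restrictions to $\Omega$ form an orthogonal basis of the complex Hilbert space $L^2(\Omega)$: the restrictions are nonzero in $L^2(\Omega)$, those of distinct elements of $\Lambda$ are orthogonal, and their linear span is dense in $L^2(\Omega)$. Then $A$ is spectral in $\mathbb{Z}^d$ if and only if $A + Q = \{a + q : a \in A,\ q \in Q\}$ is spectral in $\mathbb{R}^d$. -/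

import Mathlib

open MeasureTheory
open scoped Pointwise

/-- `Λ` is a spectrum of the set `Ω` in the abelian group `G` with Haar measure `μ`: it is a set of
continuous characters of `G` whose restrictions to `Ω` form an orthogonal basis of the Hilbert space
`L²(Ω)`, that is, they are nonzero, pairwise orthogonal, and have dense linear span. Here `v χ` is
the class of the character `χ` in `L²(Ω)`. -/
def IsSpectrum {G : Type*} [AddCommGroup G] [TopologicalSpace G] [MeasurableSpace G]
    (μ : Measure G) (Ω : Set G) (Λ : Set (AddChar G Circle)) : Prop :=
  (∀ χ ∈ Λ, Continuous χ) ∧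
  ∃ v : Λ → Lp ℂ 2 (μ.restrict Ω),
    (∀ χ : Λ, v χ =ᵐ[μ.restrict Ω] fun x => ((χ : AddChar G Circle) x : ℂ)) ∧
    (∀ χ : Λ, v χ ≠ 0) ∧
    (∀ χ ψ : Λ, χ ≠ ψ → inner ℂ (v χ) (v ψ) = 0) ∧
    (Submodule.span ℂ (Set.range v)).topologicalClosure = ⊤

/-- `Ω` is spectral in `G` (with Haar measure `μ`) if it has a spectrum. -/
def IsSpectral {G : Type*} [AddCommGroup G] [TopologicalSpace G] [MeasurableSpace G]
    (μ : Measure G) (Ω : Set G) : Prop :=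
  ∃ Λ : Set (AddChar G Circle), IsSpectrum μ Ω Λ

/-- The half-open unit cube `[0,1)^d` in `ℝ^d`. -/
def unitCube (d : ℕ) : Set (Fin d → ℝ) :=
  Set.univ.pi fun _ => Set.Ico 0 1

/-- A subset of `ℤ^d`, regarded as a subset of `ℝ^d`. -/
def latticeToReal (d : ℕ) (A : Set (Fin d → ℤ)) : Set (Fin d → ℝ) :=
  (fun (a : Fin d → ℤ) (i : Fin d) => (a i : ℝ)) '' A

/-! Write `e_t` for `expChar t`, `Q` for the unit cube, `Ω = A + Q` and `φ` for `cubeFourier`. Since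
`Ω` is a disjoint union of lattice translates of `Q`, the inner product of `e_s` and `e_t` on `Ω` is
their inner product on `A` times `φ (t - s)` (`integral_conj_expChar_mul`). Here `φ` vanishes at
nonzero integer vectors and is nonzero when all coordinates are less than 1 in absolute value.

From `ℤ^d` to `ℝ^d`: lift a spectrum of `A` to frequencies `θ` and add all integer vectors. The
factorization gives orthogonality. If `f` is orthogonal to all these characters, folding it into `Q`
and using completeness of integer exponentials there shows that, for almost every `x`, the vector
`(f (a + x))` indexed by `a ∈ A` is orthogonal to the spectrum of `A`, hence zero.

From `ℝ^d` to `ℤ^d`: a spectrum of `Ω` need not be periodic, so `|A|` good frequencies must be found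
in it. Parseval for `e_η` cut off to one cell gives `∑ |φ (η - ξ)|² = |A|` for every `η`. As `∫ |φ|²
≤ 1`, averaging over `η ∈ Q` forces some translate of `Q` to contain `|A|` frequencies
(`exists_card_le_of_le_tsum`). Their differences avoid the zeros of `φ`, so they are orthogonal on
`A`, and `|A|` orthogonal nonzero vectors span `ℂ^A`. -/

/-! ### Characters of `ℝ^d` and `ℤ^d` -/

/-- The character `x ↦ exp (2πi t·x)` of `ℝ^d`. -/
noncomputable def expChar {d : ℕ} (t : Fin d → ℝ) : AddChar (Fin d → ℝ) Circle where
  toFun x := Real.fourierChar (t ⬝ᵥ x)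
  map_zero_eq_one' := by simp
  map_add_eq_mul' x y := by rw [dotProduct_add, AddChar.map_add_eq_mul]

lemma AddChar.map_sum_eq_finsetProd {ι A M : Type*} [AddCommMonoid A] [CommMonoid M]
    (ψ : AddChar A M) (s : Finset ι) (f : ι → A) : ψ (∑ i ∈ s, f i) = ∏ i ∈ s, ψ (f i) := by
  classical
  induction s using Finset.induction_on with
  | empty => simp
  | insert a s ha ih => rw [Finset.sum_insert ha, Finset.prod_insert ha, map_add_eq_mul, ih]

/-- A vector with integer coordinates, regarded as a vector with real coordinates. -/
def intVec {d : ℕ} : (Fin d → ℤ) →+ (Fin d → ℝ) where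
  toFun n i := n i
  map_zero' := by ext; simp
  map_add' m n := by ext; simp

lemma intVec_apply {d : ℕ} (n : Fin d → ℤ) (i : Fin d) : intVec n i = n i := rfl

lemma expChar_apply {d : ℕ} (t x : Fin d → ℝ) :
    expChar t x = Real.fourierChar (t ⬝ᵥ x) := rfl

lemma continuous_expChar {d : ℕ} (t : Fin d → ℝ) : Continuous (expChar t) := by
  change Continuous fun x : Fin d → ℝ => Real.fourierChar (∑ i, t i * x i)
  fun_prop

lemma expChar_add {d : ℕ} (s t x : Fin d → ℝ) :
    expChar (s + t) x = expChar s x * expChar t x := by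
  simp [expChar_apply, add_dotProduct, AddChar.map_add_eq_mul]

lemma conj_expChar_mul {d : ℕ} (s t x : Fin d → ℝ) :
    (starRingEnd ℂ (expChar s x : ℂ)) * (expChar t x : ℂ) = (expChar (t - s) x : ℂ) := by
  have h : expChar t x = expChar (t - s) x * expChar s x := by
    rw [← expChar_add, sub_add_cancel]
  rw [h, Circle.coe_mul, mul_left_comm, ← Circle.coe_inv_eq_conj, ← Circle.coe_mul,
    inv_mul_cancel, Circle.coe_one, mul_one]

lemma fourierChar_intCast (n : ℤ) : Real.fourierChar (n : ℝ) = 1 := by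
  rw [Real.fourierChar_apply', mul_comm, Circle.exp_int_mul_two_pi]

lemma fourierChar_eq_one_iff (x : ℝ) : Real.fourierChar x = 1 ↔ ∃ n : ℤ, x = n := by
  refine ⟨fun h => ?_, fun ⟨n, h⟩ => h ▸ fourierChar_intCast n⟩
  rw [Real.fourierChar_apply', Circle.exp_eq_one] at h
  obtain ⟨n, hn⟩ := h
  refine ⟨n, mul_left_cancel₀ Real.two_pi_pos.ne' ?_⟩
  rw [hn, mul_comm]

lemma expChar_intVec_intVec {d : ℕ} (m n : Fin d → ℤ) :
    expChar (intVec m) (intVec n) = 1 := by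
  have : intVec m ⬝ᵥ intVec n = ((m ⬝ᵥ n : ℤ) : ℝ) := by
    simp [dotProduct, intVec_apply]
  rw [expChar_apply, this, fourierChar_intCast]

/-- Lift the character through the covering `ℝ → ℝ/ℤ` to a continuous `F` with `F 0 = 0`. The defect
of additivity of `F` is continuous and integer-valued on a connected space, so it is constantly its
value 0 at the origin; a continuous additive map is linear. -/
lemma exists_eq_expChar {d : ℕ} (χ : AddChar (Fin d → ℝ) Circle) (hχ : Continuous χ) :
    ∃ t, χ = expChar t := by
  let e := AddCircle.homeomorphCircle (T := (1 : ℝ)) one_ne_zero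
  have cov := AddCircle.isCoveringMap_coe (1 : ℝ)
  obtain ⟨F, ⟨hF0, hF⟩, -⟩ := cov.existsUnique_continuousMap_lifts
    (A := Fin d → ℝ) ⟨fun x => e.symm (χ x), e.symm.continuous.comp hχ⟩ 0 0 (by
      change ((0 : ℝ) : AddCircle (1 : ℝ)) = e.symm (χ 0)
      rw [Homeomorph.eq_symm_apply]
      simp [e, AddCircle.homeomorphCircle_apply])
  have hFχ (x) : Real.fourierChar (F x) = χ x := by
    have h := congrFun hF x
    change ((F x : ℝ) : AddCircle (1 : ℝ)) = e.symm (χ x) at h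
    rw [Homeomorph.eq_symm_apply] at h
    rw [← h]
    simp [e, AddCircle.homeomorphCircle_apply, AddCircle.toCircle_apply_mk,
      Real.fourierChar_apply']
  have hadd (x y) : F (x + y) = F x + F y := by
    have hc : Continuous fun p : (Fin d → ℝ) × (Fin d → ℝ) => F (p.1 + p.2) - F p.1 - F p.2 := by
      fun_prop
    have hint (p : (Fin d → ℝ) × (Fin d → ℝ)) :
        ∃ n : ℤ, F (p.1 + p.2) - F p.1 - F p.2 = n := by
      rw [← fourierChar_eq_one_iff, AddChar.map_sub_eq_div, AddChar.map_sub_eq_div,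
        hFχ, hFχ, hFχ, AddChar.map_add_eq_mul]
      simp
    choose n hn using hint
    have hnc : Continuous n := by
      rw [Int.isClosedEmbedding_coe_real.isInducing.continuous_iff]
      convert hc using 1
      ext p
      exact (hn p).symm
    have h0 := PreconnectedSpace.constant inferInstance hnc (x := (x, y)) (y := (0, 0))
    have h1 := hn (x, y)
    have h2 := hn (0, 0)
    rw [h0] at h1
    simp only [add_zero, hF0] at h1 h2
    linarith
  let f : (Fin d → ℝ) →L[ℝ] ℝ :=
    AddMonoidHom.toRealLinearMap ⟨⟨F, hF0⟩, hadd⟩ F.continuous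
  refine ⟨fun i => f (Pi.single i 1), ?_⟩
  ext x
  have : F x = (fun i => f (Pi.single i 1)) ⬝ᵥ x := by
    change f x = _
    conv_lhs => rw [← Finset.univ_sum_single x, map_sum]
    refine Finset.sum_congr rfl fun i _ => ?_
    rw [mul_comm, ← smul_eq_mul, ← map_smul, ← Pi.single_smul, smul_eq_mul, mul_one]
  rw [← hFχ, this, expChar_apply]

/-- Any logarithms of the values on the standard basis serve as coordinates of `t`. They are fixed
only modulo integers, which is the freedom used to build a spectrum in `ℝ^d`. -/
lemma exists_eq_expChar_intVec {d : ℕ} (χ : AddChar (Fin d → ℤ) Circle) :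
    ∃ t, ∀ n, χ n = expChar t (intVec n) := by
  have h (i : Fin d) : ∃ s : ℝ, Real.fourierChar s = χ (Pi.single i 1) := by
    obtain ⟨s, hs⟩ := Circle.exp_surjective (χ (Pi.single i 1))
    refine ⟨s / (2 * Real.pi), ?_⟩
    rw [Real.fourierChar_apply', mul_div_cancel₀ _ Real.two_pi_pos.ne', hs]
  choose t ht using h
  refine ⟨t, fun n => ?_⟩
  have hn : n = ∑ i, n i • Pi.single i (1 : ℤ) := by
    conv_lhs => rw [← Finset.univ_sum_single n]
    refine Finset.sum_congr rfl fun i _ => ?_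
    rw [← Pi.single_smul]; simp
  conv_lhs => rw [hn]
  rw [AddChar.map_sum_eq_finsetProd, expChar_apply, dotProduct, AddChar.map_sum_eq_finsetProd]
  refine Finset.prod_congr rfl fun i _ => ?_
  rw [AddChar.map_zsmul_eq_zpow, ← ht, ← AddChar.map_zsmul_eq_zpow, zsmul_eq_mul, intVec_apply,
    mul_comm]

/-! ### The Fourier transform of the unit cube -/

/-- The Fourier transform of the indicator function of the unit cube. -/
noncomputable def cubeFourier {d : ℕ} (t : Fin d → ℝ) : ℂ :=
  ∫ x in unitCube d, (expChar t x : ℂ)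

lemma measurableSet_unitCube (d : ℕ) : MeasurableSet (unitCube d) :=
  MeasurableSet.univ_pi fun _ => measurableSet_Ico

lemma volume_unitCube (d : ℕ) : volume (unitCube d) = 1 := by
  simp [unitCube, volume_pi_pi]

lemma cubeFourier_eq_prod {d : ℕ} (t : Fin d → ℝ) :
    cubeFourier t = ∏ i, ∫ x in (0 : ℝ)..1, (Real.fourierChar (t i * x) : ℂ) := by
  rw [cubeFourier, volume_pi, unitCube, Measure.restrict_pi_pi]
  have : (fun x => (expChar t x : ℂ)) =
      fun x : Fin d → ℝ => ∏ i, (Real.fourierChar (t i * x i) : ℂ) := by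
    ext x
    rw [expChar_apply, dotProduct, AddChar.map_sum_eq_finsetProd]
    exact map_prod Circle.coeHom _ _
  rw [this, integral_fintype_prod_eq_prod (fun i (x : ℝ) => (Real.fourierChar (t i * x) : ℂ))]
  refine Finset.prod_congr rfl fun i _ => ?_
  rw [intervalIntegral.integral_of_le zero_le_one, integral_Ico_eq_integral_Ioc]

lemma intervalIntegral_fourierChar {s : ℝ} (hs : s ≠ 0) :
    ∫ x in (0 : ℝ)..1, (Real.fourierChar (s * x) : ℂ) =
      (Real.fourierChar s - 1) / (2 * Real.pi * s * Complex.I) := by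
  have hc : (2 * Real.pi * s * Complex.I : ℂ) ≠ 0 := by
    simp [hs, Real.pi_ne_zero]
  have := integral_exp_mul_complex (a := 0) (b := 1) hc
  simp only [Complex.ofReal_zero, mul_zero, Complex.exp_zero, Complex.ofReal_one, mul_one] at this
  rw [Real.fourierChar_apply]
  push_cast
  rw [← this]
  refine intervalIntegral.integral_congr fun x _ => ?_
  simp only [Real.fourierChar_apply]
  push_cast
  ring_nf

lemma cubeFourier_zero (d : ℕ) : cubeFourier (0 : Fin d → ℝ) = 1 := by
  simp [cubeFourier_eq_prod]

lemma cubeFourier_intVec {d : ℕ} {n : Fin d → ℤ} (hn : n ≠ 0) : cubeFourier (intVec n) = 0 := by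
  obtain ⟨i, hi⟩ := Function.ne_iff.mp hn
  rw [cubeFourier_eq_prod]
  refine Finset.prod_eq_zero (Finset.mem_univ i) ?_
  rw [intVec_apply, intervalIntegral_fourierChar (by exact_mod_cast hi), fourierChar_intCast]
  simp

/-- Each factor of the product formula vanishes only at nonzero integers. -/
lemma cubeFourier_ne_zero {d : ℕ} {t : Fin d → ℝ} (ht : ∀ i, |t i| < 1) : cubeFourier t ≠ 0 := by
  rw [cubeFourier_eq_prod, Finset.prod_ne_zero_iff]
  intro i _
  by_cases h : t i = 0
  · simp [h]
  rw [intervalIntegral_fourierChar h]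
  refine div_ne_zero (sub_ne_zero.mpr fun h1 => ?_) (by simp [h, Real.pi_ne_zero])
  obtain ⟨n, hn⟩ := (fourierChar_eq_one_iff (t i)).mp (Circle.coe_eq_one.mp h1)
  have hn1 := ht i
  rw [hn] at hn1 h
  have : |n| < 1 := by exact_mod_cast hn1
  rw [Int.abs_lt_one_iff] at this
  exact h (by simp [this])

lemma continuous_cubeFourier (d : ℕ) : Continuous (cubeFourier (d := d)) := by
  have : IsFiniteMeasure (volume.restrict (unitCube d)) :=
    ⟨by simp [volume_unitCube]⟩
  refine continuous_of_dominated (bound := fun _ => 1) (fun t => ?_) (fun t => ?_) ?_ ?_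
  · exact (continuous_subtype_val.comp (continuous_expChar t)).aestronglyMeasurable
  · exact Filter.Eventually.of_forall fun x => (Circle.norm_coe _).le
  · exact integrable_const _
  · refine Filter.Eventually.of_forall fun x => ?_
    change Continuous fun t : Fin d → ℝ => (Real.fourierChar (∑ i, t i * x i) : ℂ)
    fun_prop

/-! ### Tiling of space by translates of the unit cube -/

lemma mem_unitCube {d : ℕ} {x : Fin d → ℝ} : x ∈ unitCube d ↔ ∀ i, 0 ≤ x i ∧ x i < 1 := by
  simp [unitCube]

lemma exists_sub_intVec_mem_unitCube {d : ℕ} (x : Fin d → ℝ) :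
    ∃ n, x - intVec n ∈ unitCube d :=
  ⟨fun i => ⌊x i⌋, mem_unitCube.mpr fun _ => ⟨Int.fract_nonneg _, Int.fract_lt_one _⟩⟩

lemma pairwise_disjoint_vadd_unitCube (d : ℕ) :
    Pairwise (Function.onFun Disjoint fun n : Fin d → ℤ => intVec n +ᵥ unitCube d) := by
  intro m n hmn
  rw [Function.onFun, Set.disjoint_left]
  rintro _ ⟨x, hx, rfl⟩ ⟨y, hy, hxy⟩
  refine hmn (funext fun i => ?_)
  have h := congrFun hxy i
  simp only [vadd_eq_add, Pi.add_apply, intVec_apply] at h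
  have hxi := mem_unitCube.mp hx i
  have hyi := mem_unitCube.mp hy i
  have h1 : (m i : ℝ) < n i + 1 := by linarith
  have h2 : (n i : ℝ) < m i + 1 := by linarith
  have h1 : m i < n i + 1 := by exact_mod_cast h1
  have h2 : n i < m i + 1 := by exact_mod_cast h2
  lia

lemma measurableSet_vadd_unitCube {d : ℕ} (x : Fin d → ℝ) :
    MeasurableSet (x +ᵥ unitCube d) :=
  (measurableSet_unitCube d).const_vadd x

lemma iUnion_vadd_unitCube (d : ℕ) :
    ⋃ n : Fin d → ℤ, intVec n +ᵥ unitCube d = Set.univ := by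
  refine Set.eq_univ_of_forall fun x => ?_
  obtain ⟨n, hn⟩ := exists_sub_intVec_mem_unitCube x
  exact Set.mem_iUnion.mpr ⟨n, _, hn, by simp⟩

lemma measurePreserving_vadd_unitCube {d : ℕ} (x : Fin d → ℝ) :
    MeasurePreserving (x + ·) (volume.restrict (unitCube d))
      (volume.restrict (x +ᵥ unitCube d)) := by
  have h := (measurePreserving_add_left volume x).restrict_preimage
    (measurableSet_vadd_unitCube x)
  convert h using 2
  ext y
  simp [Set.mem_vadd_set]

lemma latticeToReal_add_unitCube {d : ℕ} (A : Set (Fin d → ℤ)) :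
    latticeToReal d A + unitCube d = ⋃ a ∈ A, intVec a +ᵥ unitCube d := by
  ext x
  simp [latticeToReal, Set.mem_add, Set.mem_vadd_set, intVec]

lemma lintegral_eq_tsum_unitCube {d : ℕ} {f : (Fin d → ℝ) → ENNReal} (hf : Measurable f) :
    ∫⁻ x, f x = ∑' n : Fin d → ℤ, ∫⁻ x in unitCube d, f (intVec n + x) := by
  rw [← setLIntegral_univ, ← iUnion_vadd_unitCube, lintegral_iUnion
    (fun n => measurableSet_vadd_unitCube _) (pairwise_disjoint_vadd_unitCube d)]
  exact tsum_congr fun n => ((measurePreserving_vadd_unitCube _).lintegral_comp hf).symm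

lemma setIntegral_latticeToReal_add {d : ℕ} (A : Finset (Fin d → ℤ)) {f : (Fin d → ℝ) → ℂ}
    (hf : IntegrableOn f (latticeToReal d A + unitCube d)) :
    ∫ x in latticeToReal d A + unitCube d, f x =
      ∑ a ∈ A, ∫ x in unitCube d, f (intVec a + x) := by
  rw [latticeToReal_add_unitCube] at hf ⊢
  simp only [Finset.mem_coe] at hf ⊢
  rw [integral_biUnion_finset _ (fun _ _ => measurableSet_vadd_unitCube _)
    ((pairwise_disjoint_vadd_unitCube d).set_pairwise _)]
  · exact Finset.sum_congr rfl fun _ _ => ((measurePreserving_vadd_unitCube _).integral_comp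
      (measurableEmbedding_addLeft _) f).symm
  · intro a ha
    exact hf.mono_set (Set.subset_biUnion_of_mem (u := fun a => intVec a +ᵥ unitCube d) ha)

lemma volume_latticeToReal_add {d : ℕ} (A : Finset (Fin d → ℤ)) :
    volume (latticeToReal d A + unitCube d) = A.card := by
  rw [latticeToReal_add_unitCube]
  simp only [Finset.mem_coe]
  rw [measure_biUnion_finset ((pairwise_disjoint_vadd_unitCube d).set_pairwise _)
    (fun n _ => measurableSet_vadd_unitCube _)]
  simp [volume_unitCube, measure_vadd]

/-- On the cell `a + Q` the integrand is its value at `a` times `expChar (t - s)` on `Q`, so the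
cells contribute a common factor. -/
lemma integral_conj_expChar_mul {d : ℕ} (A : Finset (Fin d → ℤ)) (s t : Fin d → ℝ) :
    ∫ x in latticeToReal d A + unitCube d, starRingEnd ℂ (expChar s x : ℂ) * expChar t x =
      (∑ a ∈ A, starRingEnd ℂ (expChar s (intVec a) : ℂ) * expChar t (intVec a)) *
        cubeFourier (t - s) := by
  have : IsFiniteMeasure (volume.restrict (latticeToReal d A + unitCube d)) :=
    ⟨by simp [volume_latticeToReal_add]⟩
  simp only [conj_expChar_mul]
  rw [setIntegral_latticeToReal_add, Finset.sum_mul]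
  · refine Finset.sum_congr rfl fun a _ => ?_
    simp only [AddChar.map_add_eq_mul, Circle.coe_mul, cubeFourier]
    rw [integral_const_mul]
  · refine Integrable.of_bound (C := 1)
      (continuous_subtype_val.comp (continuous_expChar _)).aestronglyMeasurable ?_
    exact Filter.Eventually.of_forall fun x => (Circle.norm_coe _).le

/-! ### Orthogonality, completeness and Parseval for a spectrum -/

section General

variable {G : Type*} [AddCommGroup G] [TopologicalSpace G] [MeasurableSpace G]
  {μ : Measure G} {Ω : Set G} {Λ : Set (AddChar G Circle)}

lemma memLp_character [OpensMeasurableSpace G] [IsFiniteMeasure (μ.restrict Ω)]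
    {χ : AddChar G Circle} (hχ : Continuous χ) :
    MemLp (fun x => (χ x : ℂ)) 2 (μ.restrict Ω) :=
  .of_bound (continuous_subtype_val.comp hχ).aestronglyMeasurable 1
    (Filter.Eventually.of_forall fun _ => (Circle.norm_coe _).le)

lemma inner_eq_integral_of_ae_eq {α : Type*} [MeasurableSpace α] {ν : Measure α}
    {u v : Lp ℂ 2 ν} {f g : α → ℂ} (hu : u =ᵐ[ν] f) (hv : v =ᵐ[ν] g) :
    inner ℂ u v = ∫ x, starRingEnd ℂ (f x) * g x ∂ν := by
  rw [L2.inner_def]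
  refine integral_congr_ae ?_
  filter_upwards [hu, hv] with x hx hy
  rw [hx, hy, RCLike.inner_apply, mul_comm]

lemma circle_conj_mul_self (z : Circle) : starRingEnd ℂ (z : ℂ) * z = 1 := by
  rw [← Circle.coe_inv_eq_conj, ← Circle.coe_mul, inv_mul_cancel, Circle.coe_one]

/-- The space `L²` is trivial, so the empty spectrum works; this settles empty `A`. -/
lemma isSpectral_of_measure_zero (h : μ Ω = 0) : IsSpectral μ Ω := by
  have h0 : μ.restrict Ω = 0 := Measure.restrict_eq_zero.mpr h
  refine ⟨∅, by simp, fun χ => χ.2.elim, fun χ => χ.2.elim, fun χ => χ.2.elim,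
    fun χ => χ.2.elim, ?_⟩
  rw [Submodule.eq_top_iff']
  intro f
  have : f = 0 := by
    rw [Lp.eq_zero_iff_ae_eq_zero, Filter.EventuallyEq, ae_iff]
    simp only [h0, Measure.coe_zero, Pi.zero_apply]
  rw [this]
  exact Submodule.zero_mem _

lemma isSpectrum_of_orthogonal_of_complete [OpensMeasurableSpace G]
    [IsFiniteMeasure (μ.restrict Ω)] (hΩ : μ Ω ≠ 0) (hcont : ∀ χ ∈ Λ, Continuous χ)
    (horth : ∀ χ ∈ Λ, ∀ ψ ∈ Λ, χ ≠ ψ → ∫ x in Ω, starRingEnd ℂ (χ x : ℂ) * ψ x ∂μ = 0)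
    (hcomp : ∀ f : G → ℂ, MemLp f 2 (μ.restrict Ω) →
      (∀ χ ∈ Λ, ∫ x in Ω, starRingEnd ℂ (χ x : ℂ) * f x ∂μ = 0) → f =ᵐ[μ.restrict Ω] 0) :
    IsSpectrum μ Ω Λ := by
  have hae (χ : Λ) := (memLp_character (μ := μ) (Ω := Ω) (hcont χ χ.2)).coeFn_toLp
  refine ⟨hcont, fun χ => (memLp_character (hcont χ χ.2)).toLp _, hae, fun χ h => ?_,
    fun χ ψ h => ?_, ?_⟩
  · have h1 := inner_eq_integral_of_ae_eq (hae χ) (hae χ)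
    beta_reduce at h
    rw [h, inner_zero_left] at h1
    simp only [circle_conj_mul_self, integral_const, mul_one, measureReal_def,
      Measure.restrict_apply MeasurableSet.univ, Set.univ_inter, Complex.real_smul] at h1
    have h2 : μ Ω ≠ ⊤ := by
      simpa using measure_ne_top (μ.restrict Ω) Set.univ
    exact (ENNReal.toReal_ne_zero.mpr ⟨hΩ, h2⟩) (by exact_mod_cast h1.symm)
  · rw [inner_eq_integral_of_ae_eq (hae χ) (hae ψ)]
    exact horth χ χ.2 ψ ψ.2 (by simpa [Subtype.ext_iff] using h)
  · rw [Submodule.topologicalClosure_eq_top_iff, Submodule.eq_bot_iff]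
    intro f hf
    rw [Lp.eq_zero_iff_ae_eq_zero]
    refine hcomp f (Lp.memLp f) fun χ hχ => ?_
    have := Submodule.inner_right_of_mem_orthogonal
      (Submodule.subset_span (Set.mem_range_self (⟨χ, hχ⟩ : Λ))) hf
    rwa [inner_eq_integral_of_ae_eq (hae ⟨χ, hχ⟩) (ae_eq_refl _)] at this

lemma IsSpectrum.orthogonal (h : IsSpectrum μ Ω Λ) {χ ψ : AddChar G Circle} (hχ : χ ∈ Λ)
    (hψ : ψ ∈ Λ) (hne : χ ≠ ψ) : ∫ x in Ω, starRingEnd ℂ (χ x : ℂ) * ψ x ∂μ = 0 := by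
  obtain ⟨-, v, hv, -, ho, -⟩ := h
  rw [← inner_eq_integral_of_ae_eq (hv ⟨χ, hχ⟩) (hv ⟨ψ, hψ⟩)]
  exact ho _ _ (by simpa [Subtype.ext_iff] using hne)

lemma IsSpectrum.complete (h : IsSpectrum μ Ω Λ) {f : G → ℂ} (hf : MemLp f 2 (μ.restrict Ω))
    (h0 : ∀ χ ∈ Λ, ∫ x in Ω, starRingEnd ℂ (χ x : ℂ) * f x ∂μ = 0) :
    f =ᵐ[μ.restrict Ω] 0 := by
  obtain ⟨-, v, hv, -, -, hc⟩ := h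
  rw [Submodule.topologicalClosure_eq_top_iff, Submodule.eq_bot_iff] at hc
  have : hf.toLp f = 0 := by
    refine hc _ ?_
    rw [Submodule.mem_orthogonal]
    intro u hu
    induction hu using Submodule.span_induction with
    | mem u hu =>
      obtain ⟨χ, rfl⟩ := hu
      rw [inner_eq_integral_of_ae_eq (hv χ) hf.coeFn_toLp]
      exact h0 χ χ.2
    | zero => exact inner_zero_left _
    | add u w _ _ hu hw => rw [inner_add_left, hu, hw, add_zero]
    | smul c u _ hu => rw [inner_smul_left, hu, mul_zero]
  exact (MemLp.toLp_eq_toLp_iff hf MemLp.zero).mp this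

/-- Characters have squared norm `μ Ω`, so dividing them by its square root gives a Hilbert basis;
undoing the scaling puts the factor `μ.real Ω` on the right. -/
lemma IsSpectrum.hasSum_parseval [IsFiniteMeasure (μ.restrict Ω)] (h : IsSpectrum μ Ω Λ)
    (hΩ : μ Ω ≠ 0) {f : G → ℂ} (hf : MemLp f 2 (μ.restrict Ω)) :
    HasSum (fun χ : Λ => ‖∫ x in Ω, starRingEnd ℂ ((χ : AddChar G Circle) x : ℂ) * f x ∂μ‖ ^ 2)
      (μ.real Ω * ∫ x in Ω, ‖f x‖ ^ 2 ∂μ) := by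
  obtain ⟨-, v, hv, -, ho, hc⟩ := h
  set N := μ.real Ω
  have hN : 0 < N := by
    have h2 : μ Ω ≠ ⊤ := by
      simpa using measure_ne_top (μ.restrict Ω) Set.univ
    exact ENNReal.toReal_pos hΩ h2
  have hvv (χ) : inner ℂ (v χ) (v χ) = N := by
    rw [inner_eq_integral_of_ae_eq (hv χ) (hv χ)]
    simp [circle_conj_mul_self, N, measureReal_def]
  set c : ℂ := (((Real.sqrt N)⁻¹ : ℝ) : ℂ) with hcdef
  have hcN : starRingEnd ℂ c * c * N = 1 := by
    rw [hcdef, Complex.conj_ofReal]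
    norm_cast
    rw [← mul_inv, Real.mul_self_sqrt hN.le, inv_mul_cancel₀ hN.ne']
  have hc0 : c ≠ 0 := by rintro h; simp [h] at hcN
  have hon : Orthonormal ℂ fun χ => c • v χ := by
    classical
    rw [orthonormal_iff_ite]
    intro χ ψ
    rw [inner_smul_left, inner_smul_right]
    split_ifs with hχψ
    · rw [hχψ, hvv, ← mul_assoc, hcN]
    · rw [ho _ _ hχψ, mul_zero, mul_zero]
  have hspan : Submodule.span ℂ (Set.range fun χ => c • v χ) = Submodule.span ℂ (Set.range v) := by
    rw [← Submodule.span_smul_eq_of_isUnit (Set.range v) c hc0.isUnit]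
    congr 1
    exact (Set.smul_set_range ..).symm
  let b := HilbertBasis.mk hon (by rw [hspan, hc])
  have hb (χ) : b χ = c • v χ := by simp [b]
  have hs := b.hasSum_inner_mul_inner (hf.toLp f) (hf.toLp f)
  have hs2 := (Complex.hasSum_re hs).mul_left N
  have hterm (χ : Λ) : N * (inner ℂ (hf.toLp f) (b χ) * inner ℂ (b χ) (hf.toLp f) : ℂ).re =
      ‖∫ x in Ω, starRingEnd ℂ ((χ : AddChar G Circle) x : ℂ) * f x ∂μ‖ ^ 2 := by
    rw [hb, inner_smul_left, inner_smul_right, ← inner_conj_symm (hf.toLp f) (v χ),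
      inner_eq_integral_of_ae_eq (hv χ) hf.coeFn_toLp]
    set z := ∫ x in Ω, starRingEnd ℂ ((χ : AddChar G Circle) x : ℂ) * f x ∂μ
    have : c * starRingEnd ℂ z * (starRingEnd ℂ c * z) =
        (starRingEnd ℂ c * c * N) * (((N⁻¹ : ℝ) : ℂ) * (starRingEnd ℂ z * z)) := by
      have : (N : ℂ) ≠ 0 := by exact_mod_cast hN.ne'
      push_cast
      field_simp
    rw [this, hcN, one_mul, ← Complex.normSq_eq_conj_mul_self, Complex.normSq_eq_norm_sq,
      ← Complex.ofReal_mul, Complex.ofReal_re, mul_inv_cancel_left₀ hN.ne']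
  have hself : (inner ℂ (hf.toLp f) (hf.toLp f) : ℂ).re = ∫ x in Ω, ‖f x‖ ^ 2 ∂μ := by
    rw [inner_eq_integral_of_ae_eq hf.coeFn_toLp hf.coeFn_toLp]
    have (x : G) : starRingEnd ℂ (f x) * f x = ((‖f x‖ ^ 2 : ℝ) : ℂ) := by
      rw [← Complex.normSq_eq_conj_mul_self, Complex.normSq_eq_norm_sq]
    simp only [this]
    rw [integral_complex_ofReal]
    rfl
  rw [hself, funext hterm] at hs2
  exact hs2

end General

/-! ### Spectra of finite subsets of the lattice -/

instance isFiniteMeasure_count_restrict {d : ℕ} (A : Finset (Fin d → ℤ)) :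
    IsFiniteMeasure (Measure.count.restrict (A : Set (Fin d → ℤ))) :=
  ⟨by simp [Measure.count_apply_finset]⟩

lemma integral_count_finset {d : ℕ} (A : Finset (Fin d → ℤ)) (f : (Fin d → ℤ) → ℂ) :
    ∫ x in (A : Set (Fin d → ℤ)), f x ∂Measure.count = ∑ a ∈ A, f a := by
  have hf : IntegrableOn f A Measure.count := by
    simpa [IntegrableOn, Measure.restrict_restrict A.measurableSet] using
      IntegrableOn.finset (μ := Measure.count.restrict (A : Set (Fin d → ℤ))) (s := A) (f := f)
  rw [setIntegral_finset _ hf]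
  simp [measureReal_def]

lemma ae_count_restrict_iff {d : ℕ} (A : Finset (Fin d → ℤ)) (p : (Fin d → ℤ) → Prop) :
    (∀ᵐ a ∂(Measure.count.restrict (A : Set (Fin d → ℤ))), p a) ↔ ∀ a ∈ A, p a := by
  rw [ae_restrict_iff' A.measurableSet, Measure.ae_count_iff]
  simp

instance isFiniteMeasure_volume_restrict {d : ℕ} (A : Finset (Fin d → ℤ)) :
    IsFiniteMeasure (volume.restrict (latticeToReal d A + unitCube d)) :=
  ⟨by simp [volume_latticeToReal_add]⟩

lemma eq_zero_of_orthogonal {ι κ : Type*} [Fintype ι] [Fintype κ]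
    (hcard : Fintype.card ι = Fintype.card κ) (ψ : ι → EuclideanSpace ℂ κ)
    (hne : ∀ i, ψ i ≠ 0) (horth : Pairwise fun i j => inner ℂ (ψ i) (ψ j) = 0)
    (c : EuclideanSpace ℂ κ) (hc : ∀ i, inner ℂ (ψ i) c = 0) : c = 0 := by
  have hli := linearIndependent_of_ne_zero_of_inner_eq_zero hne horth
  have hspan := hli.span_eq_top_of_card_eq_finrank' (by rw [hcard, finrank_euclideanSpace])
  have hmem : c ∈ Submodule.span ℂ (Set.range ψ) := hspan ▸ Submodule.mem_top
  rw [← inner_self_eq_zero (𝕜 := ℂ)]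
  have : ∀ u ∈ Submodule.span ℂ (Set.range ψ), inner ℂ u c = 0 := by
    intro u hu
    induction hu using Submodule.span_induction with
    | mem u hu => obtain ⟨i, rfl⟩ := hu; exact hc i
    | zero => exact inner_zero_left _
    | add u w _ _ hu hw => rw [inner_add_left, hu, hw, add_zero]
    | smul c u _ hu => rw [inner_smul_left, hu, mul_zero]
  exact this c hmem

lemma isSpectral_count_of_card {d : ℕ} {A : Finset (Fin d → ℤ)} (hA : A.Nonempty)
    {ι : Type*} [Fintype ι] (hcard : Fintype.card ι = A.card)
    (ψ : ι → AddChar (Fin d → ℤ) Circle)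
    (horth : Pairwise fun i j => ∑ a ∈ A, starRingEnd ℂ (ψ i a : ℂ) * ψ j a = 0) :
    IsSpectral Measure.count (A : Set (Fin d → ℤ)) := by
  refine ⟨Set.range ψ, isSpectrum_of_orthogonal_of_complete ?_ ?_ ?_ ?_⟩
  · simpa [Measure.count_apply_finset] using hA.ne_empty
  · exact fun χ _ => continuous_of_discreteTopology
  · rintro _ ⟨i, rfl⟩ _ ⟨j, rfl⟩ hij
    rw [integral_count_finset]
    exact horth fun h => hij (congrArg ψ h)
  · intro f _ hf
    have hψ (i : ι) (g : (Fin d → ℤ) → ℂ) :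
        inner ℂ (WithLp.toLp 2 fun a : A => (ψ i a : ℂ)) (WithLp.toLp 2 fun a : A => g a) =
          ∑ a ∈ A, starRingEnd ℂ (ψ i a : ℂ) * g a := by
      rw [PiLp.inner_apply, ← Finset.sum_coe_sort A]
      simp [mul_comm]
    have := eq_zero_of_orthogonal (by simpa using hcard)
      (fun i => WithLp.toLp 2 fun a : A => (ψ i a : ℂ)) (fun i h => ?_) (fun i j hij => ?_)
      (WithLp.toLp 2 fun a : A => f a) (fun i => ?_)
    · refine (ae_count_restrict_iff A _).mpr fun a ha => ?_
      simpa using congrArg (fun w : EuclideanSpace ℂ A => w ⟨a, ha⟩) this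
    · obtain ⟨a, ha⟩ := hA
      simpa using congrArg (fun w : EuclideanSpace ℂ A => w ⟨a, ha⟩) h
    · exact (hψ i fun a => ψ j a).trans (horth hij)
    · rw [hψ, ← integral_count_finset]
      exact hf _ ⟨i, rfl⟩

/-! ### Energy bounds for `cubeFourier` and the averaging argument -/

instance isFiniteMeasure_restrict_unitCube (d : ℕ) :
    IsFiniteMeasure (volume.restrict (unitCube d)) :=
  ⟨by simp [volume_unitCube]⟩

/-- Bessel's inequality on the cube: the terms are the squared coefficients of the unit vector
`expChar x` against the orthonormal family `expChar (-intVec n)`. -/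
lemma tsum_enorm_cubeFourier_sq_le {d : ℕ} (x : Fin d → ℝ) :
    ∑' n : Fin d → ℤ, ‖cubeFourier (intVec n + x)‖ₑ ^ 2 ≤ 1 := by
  have hm (t : Fin d → ℝ) := memLp_character (μ := volume) (Ω := unitCube d) (continuous_expChar t)
  have hinner (s t) : inner ℂ ((hm s).toLp _) ((hm t).toLp _) = cubeFourier (t - s) := by
    rw [inner_eq_integral_of_ae_eq (hm s).coeFn_toLp (hm t).coeFn_toLp]
    simp only [conj_expChar_mul, cubeFourier]
  have hon : Orthonormal ℂ fun n : Fin d → ℤ => (hm (-intVec n)).toLp _ := by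
    classical
    rw [orthonormal_iff_ite]
    intro m n
    rw [hinner]
    split_ifs with h
    · rw [h, sub_self, cubeFourier_zero]
    · rw [sub_neg_eq_add, neg_add_eq_sub, ← map_sub, cubeFourier_intVec (sub_ne_zero.mpr h)]
  rw [ENNReal.tsum_eq_iSup_sum]
  refine iSup_le fun s => ?_
  have hb := hon.sum_inner_products_le (s := s) ((hm x).toLp _)
  have hx : ‖(hm x).toLp _‖ ^ 2 = 1 := by
    rw [← inner_self_eq_norm_sq (𝕜 := ℂ), hinner, sub_self, cubeFourier_zero]
    simp
  rw [hx] at hb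
  calc ∑ n ∈ s, ‖cubeFourier (intVec n + x)‖ₑ ^ 2
      = ∑ n ∈ s, ENNReal.ofReal (‖cubeFourier (intVec n + x)‖ ^ 2) := by
        refine Finset.sum_congr rfl fun n _ => ?_
        rw [ENNReal.ofReal_pow (norm_nonneg _), ofReal_norm]
    _ = ENNReal.ofReal (∑ n ∈ s, ‖cubeFourier (intVec n + x)‖ ^ 2) :=
        (ENNReal.ofReal_sum_of_nonneg fun n _ => by positivity).symm
    _ ≤ 1 := by
        rw [ENNReal.ofReal_le_one]
        refine le_trans (le_of_eq ?_) hb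
        refine Finset.sum_congr rfl fun n _ => ?_
        rw [hinner, sub_neg_eq_add, add_comm]

lemma measurable_enorm_cubeFourier_sq (d : ℕ) :
    Measurable fun x : Fin d → ℝ => ‖cubeFourier x‖ₑ ^ 2 :=
  ((continuous_cubeFourier d).measurable.enorm).pow_const 2

lemma lintegral_enorm_cubeFourier_sq_le (d : ℕ) :
    ∫⁻ x : Fin d → ℝ, ‖cubeFourier x‖ₑ ^ 2 ≤ 1 := by
  have hg := measurable_enorm_cubeFourier_sq d
  rw [lintegral_eq_tsum_unitCube hg]
  calc ∑' n : Fin d → ℤ, ∫⁻ x in unitCube d, ‖cubeFourier (intVec n + x)‖ₑ ^ 2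
      = ∫⁻ x in unitCube d, ∑' n : Fin d → ℤ, ‖cubeFourier (intVec n + x)‖ₑ ^ 2 :=
        (lintegral_tsum fun n => (hg.comp (measurable_const_add _)).aemeasurable).symm
    _ ≤ ∫⁻ x in unitCube d, 1 := lintegral_mono fun x => tsum_enorm_cubeFourier_sq_le x
    _ = 1 := by simp [volume_unitCube]

/-- If the translates of `|cubeFourier|²` along a family `ξ` add up to at least `N` everywhere,
then some unit cube contains `N` members of the family. -/
lemma exists_card_le_of_le_tsum {d : ℕ} {ι : Type*} (ξ : ι → Fin d → ℝ) (N : ℕ)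
    (h : ∀ η, (N : ENNReal) ≤ ∑' i, ‖cubeFourier (η - ξ i)‖ₑ ^ 2) :
    ∃ x : Fin d → ℝ, ∃ s : Finset ι, s.card = N ∧ ∀ i ∈ s, x + ξ i ∈ unitCube d := by
  by_contra! hcon
  have hlt (x : Fin d → ℝ) (s : Finset ι) (hs : ∀ i ∈ s, x + ξ i ∈ unitCube d) : s.card < N := by
    by_contra! hN
    obtain ⟨t, hts, ht⟩ := Finset.exists_subset_card_eq hN
    obtain ⟨i, hi, hi2⟩ := hcon x t ht
    exact hi2 (hs i (hts hi))
  -- This makes the truncated `N - 1` strictly smaller than `N`.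
  have hNpos : 0 < N := lt_of_le_of_lt (Nat.zero_le _) (hlt 0 ∅ (by simp))
  have hfin (n : Fin d → ℤ) : {i | ξ i - intVec n ∈ unitCube d}.Finite := by
    by_contra hinf
    obtain ⟨s, hs, hsc⟩ := Set.Infinite.exists_subset_card_eq hinf N
    refine (hlt (-intVec n) s fun i hi => ?_).ne hsc
    rw [neg_add_eq_sub]
    exact hs hi
  -- Countability, needed to exchange sum and integral, holds because each of the countably many
  -- lattice cells contains finitely many members.
  have hcount : Countable ι := by
    rw [← Set.countable_univ_iff]
    refine (Set.countable_iUnion fun n => (hfin n).countable).mono fun i _ => ?_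
    exact Set.mem_iUnion.mpr (exists_sub_intVec_mem_unitCube (ξ i))
  have hg := measurable_enorm_cubeFourier_sq d
  have hQ := measurableSet_unitCube d
  have key : (N : ENNReal) ≤ ((N - 1 : ℕ) : ENNReal) := by
    calc (N : ENNReal) = ∫⁻ _ in unitCube d, (N : ENNReal) := by simp [volume_unitCube]
      _ ≤ ∫⁻ η in unitCube d, ∑' i, ‖cubeFourier (η - ξ i)‖ₑ ^ 2 := lintegral_mono h
      _ = ∑' i, ∫⁻ η in unitCube d, ‖cubeFourier (η - ξ i)‖ₑ ^ 2 :=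
          lintegral_tsum fun i => (hg.comp (measurable_sub_const _)).aemeasurable
      -- Substituting `η = t + ξ i` moves the dependence on `i` into an indicator, so that the sum
      -- over `i` counts members in a translated cube.
      _ = ∑' i, ∫⁻ t, (unitCube d).indicator 1 (t + ξ i) * ‖cubeFourier t‖ₑ ^ 2 := by
          refine tsum_congr fun i => ?_
          rw [← lintegral_indicator hQ, ← lintegral_add_right_eq_self _ (ξ i)]
          refine lintegral_congr fun t => ?_
          by_cases ht : t + ξ i ∈ unitCube d <;> simp [ht]
      _ = ∫⁻ t, ∑' i, (unitCube d).indicator 1 (t + ξ i) * ‖cubeFourier t‖ₑ ^ 2 := by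
          refine (lintegral_tsum fun i => Measurable.aemeasurable (.mul ?_ hg)).symm
          exact (measurable_one.indicator hQ).comp (measurable_add_const _)
      _ ≤ ∫⁻ t, ((N - 1 : ℕ) : ENNReal) * ‖cubeFourier t‖ₑ ^ 2 := by
          refine lintegral_mono fun t => ?_
          rw [ENNReal.tsum_mul_right]
          gcongr
          rw [ENNReal.tsum_eq_iSup_sum]
          refine iSup_le fun s => ?_
          classical
          have := hlt t (s.filter fun i => t + ξ i ∈ unitCube d) (by simp)
          simp only [Set.indicator_apply, Pi.one_apply, Finset.sum_boole]
          exact_mod_cast Nat.le_sub_one_of_lt this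
      _ = ((N - 1 : ℕ) : ENNReal) * ∫⁻ t : Fin d → ℝ, ‖cubeFourier t‖ₑ ^ 2 :=
          lintegral_const_mul _ hg
      _ ≤ ((N - 1 : ℕ) : ENNReal) * 1 := by gcongr; exact lintegral_enorm_cubeFourier_sq_le d
      _ = _ := mul_one _
  have : N ≤ N - 1 := by exact_mod_cast key
  lia

/-! ### From `ℝ^d` to `ℤ^d` -/

lemma isSpectral_count_of_isSpectral_volume {d : ℕ} (A : Finset (Fin d → ℤ))
    (h : IsSpectral volume (latticeToReal d A + unitCube d)) :
    IsSpectral Measure.count (A : Set (Fin d → ℤ)) := by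
  rcases A.eq_empty_or_nonempty with rfl | hA
  · exact isSpectral_of_measure_zero (by simp)
  obtain ⟨Λ, hΛ⟩ := h
  have hcont := hΛ.1
  choose ξ hξ using fun χ : Λ => exists_eq_expChar χ.1 (hcont χ χ.2)
  have hvol : volume (latticeToReal d A + unitCube d) ≠ 0 := by
    rw [volume_latticeToReal_add]
    exact_mod_cast hA.card_pos.ne'
  obtain ⟨a, ha⟩ := hA
  set Ω := latticeToReal d A + unitCube d with hΩ
  have hsub : intVec a +ᵥ unitCube d ⊆ Ω := by
    rw [hΩ, latticeToReal_add_unitCube]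
    exact Set.subset_biUnion_of_mem (u := fun a => intVec a +ᵥ unitCube d) ha
  have hms := measurableSet_vadd_unitCube (intVec a)
  have hpars (η : Fin d → ℝ) :
      -- The Parseval test function is `expChar η` cut off to the single cell at `a`: its norm is 1,
      -- and shifting the cell to `Q` changes coefficients only by unimodular factors.
      HasSum (fun χ : Λ => ‖cubeFourier (η - ξ χ)‖ ^ 2) (A.card : ℝ) := by
    have hm : MemLp ((intVec a +ᵥ unitCube d).indicator fun x => (expChar η x : ℂ)) 2
        (volume.restrict Ω) := (memLp_character (continuous_expChar η)).indicator hms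
    have hs := hΛ.hasSum_parseval hvol hm
    have hrestrict : (volume.restrict Ω).restrict (intVec a +ᵥ unitCube d) =
        volume.restrict (intVec a +ᵥ unitCube d) := by
      rw [Measure.restrict_restrict hms, Set.inter_eq_left.mpr hsub]
    have hterm (χ : Λ) : ‖∫ x in Ω, starRingEnd ℂ ((χ : AddChar (Fin d → ℝ) Circle) x : ℂ) *
        (intVec a +ᵥ unitCube d).indicator (fun x => (expChar η x : ℂ)) x‖ ^ 2 =
        ‖cubeFourier (η - ξ χ)‖ ^ 2 := by
      have : (fun x => starRingEnd ℂ ((χ : AddChar (Fin d → ℝ) Circle) x : ℂ) *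
          (intVec a +ᵥ unitCube d).indicator (fun x => (expChar η x : ℂ)) x) =
          (intVec a +ᵥ unitCube d).indicator fun x =>
            starRingEnd ℂ ((χ : AddChar (Fin d → ℝ) Circle) x : ℂ) * (expChar η x : ℂ) := by
        ext x
        by_cases hx : x ∈ intVec a +ᵥ unitCube d <;> simp [hx]
      rw [this, integral_indicator hms, hrestrict, ← (measurePreserving_vadd_unitCube _).integral_comp
        (measurableEmbedding_addLeft _), hξ χ]
      simp only [conj_expChar_mul]
      simp only [AddChar.map_add_eq_mul, Circle.coe_mul]
      rw [integral_const_mul, norm_mul, Circle.norm_coe, one_mul, cubeFourier]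
    have hnorm : ∫ x in Ω, ‖(intVec a +ᵥ unitCube d).indicator
        (fun x => (expChar η x : ℂ)) x‖ ^ 2 = 1 := by
      have : (fun x => ‖(intVec a +ᵥ unitCube d).indicator
          (fun x => (expChar η x : ℂ)) x‖ ^ 2) = (intVec a +ᵥ unitCube d).indicator 1 := by
        ext x
        by_cases hx : x ∈ intVec a +ᵥ unitCube d <;> simp [hx, Circle.norm_coe (expChar η x)]
      rw [this, integral_indicator hms, hrestrict]
      simp [measureReal_def, measure_vadd, volume_unitCube]
    rw [funext hterm, hnorm, mul_one, measureReal_def, hΩ, volume_latticeToReal_add] at hs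
    simpa using hs
  obtain ⟨x, s, hs, hsx⟩ := exists_card_le_of_le_tsum ξ A.card fun η => by
    have h1 := ENNReal.ofReal_tsum_of_nonneg (fun χ => by positivity) (hpars η).summable
    rw [(hpars η).tsum_eq, ENNReal.ofReal_natCast] at h1
    rw [h1]
    refine (tsum_congr fun χ => ?_).le
    rw [ENNReal.ofReal_pow (norm_nonneg _), ofReal_norm]
  refine isSpectral_count_of_card ⟨a, ha⟩ (ι := s) ((Fintype.card_coe s).trans hs)
    (fun χ => (expChar (ξ χ)).compAddMonoidHom intVec) fun χ ψ hne => ?_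
  have horth := hΛ.orthogonal χ.1.2 ψ.1.2 fun h => hne (Subtype.ext (Subtype.ext h))
  rw [hξ χ.1, hξ ψ.1, integral_conj_expChar_mul] at horth
  -- Two points of one half-open unit cube differ by less than 1 in each coordinate, so the cube
  -- factor is nonzero and the sum over `A` must vanish.
  refine (mul_eq_zero.mp horth).resolve_right (cubeFourier_ne_zero fun i => ?_)
  have h1 := mem_unitCube.mp (hsx _ χ.2) i
  have h2 := mem_unitCube.mp (hsx _ ψ.2) i
  simp only [Pi.add_apply, Pi.sub_apply] at h1 h2 ⊢
  rw [abs_lt]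
  constructor <;> linarith

/-! ### Completeness of integer exponentials on the cube -/

section Torus

attribute [local instance] instMeasureSpaceUnitAddCircle

open UnitAddTorus

lemma mFourier_neg_eq_conj_expChar {d : ℕ} (n : Fin d → ℤ) (x : Fin d → ℝ) :
    mFourier (-n) (fun i => (x i : UnitAddCircle)) =
      starRingEnd ℂ (expChar (intVec n) x : ℂ) := by
  rw [mFourier_neg]
  congr 1
  rw [expChar_apply, dotProduct, AddChar.map_sum_eq_finsetProd]
  refine Eq.trans (b := ∏ i, (Real.fourierChar (intVec n i * x i) : ℂ)) ?_
    (map_prod Circle.coeHom (fun i => Real.fourierChar (intVec n i * x i)) Finset.univ).symm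
  change ∏ i, fourier (n i) (x i : UnitAddCircle) = _
  refine Finset.prod_congr rfl fun i _ => ?_
  rw [fourier_coe_apply]
  rw [Real.fourierChar_apply, intVec_apply]
  push_cast
  ring_nf

lemma unitCube_ae_eq_Ioc (d : ℕ) :
    unitCube d =ᵐ[volume] {x : Fin d → ℝ | ∀ i, x i ∈ Set.Ioc ((0 : Fin d → ℝ) i) (0 + 1)} := by
  have h1 := Measure.univ_pi_Ico_ae_eq_Icc (μ := fun _ : Fin d => (volume : Measure ℝ))
    (f := 0) (g := 1)
  have h2 := Measure.univ_pi_Ioc_ae_eq_Icc (μ := fun _ : Fin d => (volume : Measure ℝ))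
    (f := 0) (g := 1)
  have h := h1.trans h2.symm
  rw [← volume_pi] at h
  have hI : {x : Fin d → ℝ | ∀ i, x i ∈ Set.Ioc ((0 : Fin d → ℝ) i) (0 + 1)} =
      Set.univ.pi fun i => Set.Ioc ((0 : Fin d → ℝ) i) ((1 : Fin d → ℝ) i) := by
    ext x
    simp [Set.mem_pi]
  rw [hI]
  exact h

/-- The exponentials with integer frequencies are complete in `L²` of the unit cube. -/
lemma ae_eq_zero_of_integral_conj_expChar_intVec {d : ℕ} {f : (Fin d → ℝ) → ℂ}
    (hf : MemLp f 2 (volume.restrict (unitCube d)))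
    (h : ∀ n, ∫ x in unitCube d, starRingEnd ℂ (expChar (intVec n) x : ℂ) * f x = 0) :
    f =ᵐ[volume.restrict (unitCube d)] 0 := by
  set C := {x : Fin d → ℝ | ∀ i, x i ∈ Set.Ioc ((0 : Fin d → ℝ) i) ((0 : Fin d → ℝ) i + 1)} with hC
  -- The fundamental domain used for the torus is `(0,1]^d`, which differs from `unitCube d` by a
  -- null set. The claim is then transported to the Fourier basis of the torus.
  have hQC : unitCube d =ᵐ[volume] C := by simpa [hC] using unitCube_ae_eq_Ioc d
  have hCm : MeasurableSet C := MeasurableSet.univ_pi' fun i => measurableSet_Ioc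
  rw [Measure.restrict_congr_set hQC] at hf ⊢
  have e := measurePreserving_equivPiIoc (0 : Fin d → ℝ)
  have hval : MeasurePreserving (Subtype.val : C → Fin d → ℝ) (volume.comap Subtype.val)
      (volume.restrict C) := ⟨measurable_subtype_coe, map_comap_subtype_coe hCm _⟩
  have hmp : MeasurePreserving (fun z : UnitAddTorus (Fin d) => (measurableEquivPiIoc 0 z).1)
      volume (volume.restrict C) := hval.comp e
  have hemb : MeasurableEmbedding
      (fun z : UnitAddTorus (Fin d) => (measurableEquivPiIoc 0 z).1) :=
    (MeasurableEmbedding.subtype_coe hCm).comp (measurableEquivPiIoc 0).measurableEmbedding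
  set g : UnitAddTorus (Fin d) → ℂ := fun z => f (measurableEquivPiIoc 0 z).1 with hg
  have hgm : MemLp g 2 volume := hf.comp_measurePreserving hmp
  have hcoef (n : Fin d → ℤ) : mFourierCoeff g n = 0 := by
    rw [mFourierCoeff_eq_integral g n 0, ← h n, setIntegral_congr_set hQC]
    refine setIntegral_congr_fun hCm fun x hx => ?_
    have hx' : (measurableEquivPiIoc 0 fun i => (x i : UnitAddCircle)).1 = x := by
      have := (measurableEquivPiIoc (0 : Fin d → ℝ)).apply_symm_apply ⟨x, hx⟩
      exact congrArg Subtype.val this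
    simp only [mFourier_neg_eq_conj_expChar, smul_eq_mul, hg, hx']
  have hg0 : hgm.toLp g = 0 := by
    refine (mFourierBasis (d := Fin d)).repr.injective ?_
    ext n
    rw [mFourierBasis_repr, map_zero]
    refine Eq.trans ?_ (hcoef n)
    refine integral_congr_ae ?_
    filter_upwards [hgm.coeFn_toLp] with z hz
    rw [hz]
  have hae : g =ᵐ[volume] 0 := (MemLp.toLp_eq_toLp_iff hgm MemLp.zero).mp hg0
  rw [← hmp.map_eq]
  exact hemb.ae_map_iff.mpr hae

end Torus

/-! ### From `ℤ^d` to `ℝ^d` -/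

lemma memLp_count_restrict {d : ℕ} (A : Finset (Fin d → ℤ)) (f : (Fin d → ℤ) → ℂ) :
    MemLp f 2 (Measure.count.restrict (A : Set (Fin d → ℤ))) := by
  refine .of_bound (measurable_of_countable f).aestronglyMeasurable (∑ a ∈ A, ‖f a‖) ?_
  exact (ae_count_restrict_iff A _).mpr fun a ha =>
    Finset.single_le_sum (f := fun a => ‖f a‖) (fun _ _ => norm_nonneg _) ha

/-- Orthogonal nonzero vectors in `ℂ^A` are linearly independent. Finiteness later allows
intersecting almost-everywhere statements over the spectrum. -/
lemma IsSpectrum.finite_of_count {d : ℕ} {A : Finset (Fin d → ℤ)} (hA : A.Nonempty)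
    {Λ : Set (AddChar (Fin d → ℤ) Circle)}
    (h : IsSpectrum Measure.count (A : Set (Fin d → ℤ)) Λ) : Finite Λ := by
  have hli := linearIndependent_of_ne_zero_of_inner_eq_zero (𝕜 := ℂ)
    (v := fun χ : Λ => (WithLp.toLp 2 fun a : A => (χ.1 a : ℂ) : EuclideanSpace ℂ A))
    (fun χ h0 => by
      obtain ⟨a, ha⟩ := hA
      simpa using congrArg (fun w : EuclideanSpace ℂ A => w ⟨a, ha⟩) h0)
    (fun χ ψ hne => by
      have := h.orthogonal χ.2 ψ.2 fun h => hne (Subtype.ext h)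
      rw [integral_count_finset, ← Finset.sum_coe_sort A] at this
      beta_reduce
      rw [PiLp.inner_apply]
      simpa [mul_comm] using this)
  exact hli.finite

lemma ae_restrict_latticeToReal_add {d : ℕ} (A : Finset (Fin d → ℤ)) (p : (Fin d → ℝ) → Prop) :
    (∀ᵐ x ∂(volume.restrict (latticeToReal d A + unitCube d)), p x) ↔
      ∀ a ∈ A, ∀ᵐ x ∂(volume.restrict (unitCube d)), p (intVec a + x) := by
  rw [latticeToReal_add_unitCube]
  simp only [Finset.mem_coe]
  rw [ae_restrict_biUnion_finset_iff]
  refine forall₂_congr fun a _ => ?_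
  rw [← (measurePreserving_vadd_unitCube (intVec a)).map_eq,
    (measurableEmbedding_addLeft _).ae_map_iff]

lemma MeasureTheory.MemLp.comp_intVec_add {d : ℕ} {A : Finset (Fin d → ℤ)}
    {f : (Fin d → ℝ) → ℂ}
    (hf : MemLp f 2 (volume.restrict (latticeToReal d A + unitCube d))) {a : Fin d → ℤ}
    (ha : a ∈ A) : MemLp (fun x => f (intVec a + x)) 2 (volume.restrict (unitCube d)) := by
  refine (hf.mono_measure (Measure.restrict_mono ?_ le_rfl)).comp_measurePreserving
    (measurePreserving_vadd_unitCube (intVec a))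
  rw [latticeToReal_add_unitCube]
  exact Set.subset_biUnion_of_mem (u := fun a => intVec a +ᵥ unitCube d) ha

lemma expChar_add_intVec {d : ℕ} (t : Fin d → ℝ) (m n : Fin d → ℤ) :
    expChar (t + intVec m) (intVec n) = expChar t (intVec n) := by
  rw [expChar_add, expChar_intVec_intVec, mul_one]

lemma isSpectral_volume_of_isSpectral_count {d : ℕ} (A : Finset (Fin d → ℤ))
    (h : IsSpectral Measure.count (A : Set (Fin d → ℤ))) :
    IsSpectral volume (latticeToReal d A + unitCube d) := by
  rcases A.eq_empty_or_nonempty with rfl | hA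
  · exact isSpectral_of_measure_zero (by rw [volume_latticeToReal_add]; simp)
  obtain ⟨Λ, hΛ⟩ := h
  have hfin := hΛ.finite_of_count hA
  choose θ hθ using fun χ : Λ => exists_eq_expChar_intVec χ.1
  refine ⟨Set.range fun p : Λ × (Fin d → ℤ) => expChar (θ p.1 + intVec p.2),
    isSpectrum_of_orthogonal_of_complete ?_ ?_ ?_ ?_⟩
  · rw [volume_latticeToReal_add]
    exact_mod_cast hA.card_pos.ne'
  · rintro _ ⟨p, rfl⟩
    exact continuous_expChar _
  · rintro _ ⟨⟨χ, m⟩, rfl⟩ _ ⟨⟨ψ, n⟩, rfl⟩ hne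
    rw [integral_conj_expChar_mul]
    simp only [expChar_add_intVec, ← hθ]
    by_cases hχψ : χ = ψ
    · subst hχψ
      rw [add_sub_add_left_eq_sub, ← map_sub, cubeFourier_intVec, mul_zero]
      rw [sub_ne_zero]
      rintro rfl
      exact hne rfl
    · rw [← integral_count_finset A fun a => starRingEnd ℂ (χ.1 a : ℂ) * ψ.1 a,
        hΛ.orthogonal χ.2 ψ.2 fun h => hχψ (Subtype.ext h), zero_mul]
  · intro f hf h0
    have hsum (χ : Λ) : ∀ᵐ x ∂(volume.restrict (unitCube d)),
        ∑ a ∈ A, starRingEnd ℂ (χ.1 a : ℂ) * f (intVec a + x) = 0 := by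
      have hmem (t : Fin d → ℝ) : MemLp (fun x => starRingEnd ℂ (expChar t x : ℂ) * f x) 2
          (volume.restrict (latticeToReal d A + unitCube d)) := by
        refine hf.of_le ((Complex.continuous_conj.comp (continuous_subtype_val.comp
          (continuous_expChar t))).aestronglyMeasurable.mul hf.1) ?_
        refine Filter.Eventually.of_forall fun x => ?_
        rw [norm_mul, RCLike.norm_conj, Circle.norm_coe, one_mul]
      have hF : MemLp (fun x => ∑ a ∈ A, starRingEnd ℂ (expChar (θ χ) (intVec a + x) : ℂ) *
          f (intVec a + x)) 2 (volume.restrict (unitCube d)) :=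
        memLp_finsetSum A fun a ha => (hmem (θ χ)).comp_intVec_add ha
      -- Since `expChar (intVec n)` is 1 on the lattice, folding the orthogonality relation at `θ χ
      -- + intVec n` into the cube says that the `n`-th Fourier coefficient of the folded function
      -- is zero.
      have hF0 := ae_eq_zero_of_integral_conj_expChar_intVec hF fun n => by
        have hn := h0 _ ⟨(χ, n), rfl⟩
        have hi := (hmem (θ χ + intVec n)).integrable one_le_two
        rw [setIntegral_latticeToReal_add A hi, ← integral_finsetSum] at hn
        · rw [← hn]
          refine integral_congr_ae (Filter.Eventually.of_forall fun x => ?_)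
          simp only [Finset.mul_sum]
          refine Finset.sum_congr rfl fun a _ => ?_
          rw [expChar_add, AddChar.map_add_eq_mul (expChar (intVec n)), expChar_intVec_intVec,
            one_mul, Circle.coe_mul, map_mul]
          ring
        · intro a ha
          exact ((hmem (θ χ + intVec n)).comp_intVec_add ha).integrable one_le_two
      filter_upwards [hF0] with x hx
      simp only [AddChar.map_add_eq_mul, ← hθ, Circle.coe_mul, map_mul, Pi.zero_apply] at hx
      -- The factor depending only on `x` is unimodular and cancels, leaving the pairing with `χ` on
      -- `A`.
      have hne : starRingEnd ℂ (expChar (θ χ) x : ℂ) ≠ 0 := by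
        rw [← norm_ne_zero_iff, RCLike.norm_conj, Circle.norm_coe]
        exact one_ne_zero
      refine (mul_eq_zero.mp (?_ : starRingEnd ℂ (expChar (θ χ) x : ℂ) * _ = 0)).resolve_left hne
      rw [← hx, Finset.mul_sum]
      exact Finset.sum_congr rfl fun a _ => by ring
    have hall : ∀ᵐ x ∂(volume.restrict (unitCube d)), ∀ a ∈ A, f (intVec a + x) = 0 := by
      filter_upwards [ae_all_iff.mpr hsum] with x hx
      refine (ae_count_restrict_iff A _).mp
        (hΛ.complete (memLp_count_restrict A fun a => f (intVec a + x)) fun χ hχ => ?_)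
      rw [integral_count_finset]
      exact hx ⟨χ, hχ⟩
    refine (ae_restrict_latticeToReal_add A _).mpr fun a ha => ?_
    filter_upwards [hall] with x hx
    exact hx a ha

theorem theorem4p2 (d : ℕ) (A : Set (Fin d → ℤ)) (hA : A.Finite) :
    IsSpectral (Measure.count : Measure (Fin d → ℤ)) A ↔
      IsSpectral (volume : Measure (Fin d → ℝ)) (latticeToReal d A + unitCube d) := by
  lift A to Finset (Fin d → ℤ) using hA
  exact ⟨isSpectral_volume_of_isSpectral_count A, isSpectral_count_of_isSpectral_volume A⟩
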